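/- Let $F$ be a field of characteristic $2$, and let $\varphi$ be a quadratic form on a finite-dimensional $F$-vector space $V$. Assume that $\varphi$ is nondefective, i.e. its quasilinear index is $0$: no nonzero vector $v$ in the radical of the polar form of $\varphi$ satisfies $\varphi(v)=0$. Assume also that $\varphi$ represents $1$ over $F$. For a field extension $E/F$ let $\varphi_E$ be the scalar extension of $\varphi$ to $E\otimes_F V$, let $D_E^*(\varphi)$ be the set of nonzero elements of $E$ represented by $\varphi_E$, and let $\langle D_E^*(\varphi)\rangle$ be the subgroup of $E^*$ generated by $D_E^*(\varphi)$. Let $\boldsymbol{X}=(X_1,\dots,X_l)$ with $l\geq 1$, and call a polynomial in $F[\boldsymbol{X}]$ monic if its leading coefficient with respect to the lexicographical ordering is $1$. For an irreducible polynomial $p\in F[\boldsymbol{X}]$ let $F(p)$ be the quotient field of $F[\boldsymbol{X}]/(p)$. Let $a\in F^*$, let $f_1,\dots,f_r,g\in F[\boldsymbol{X}]$ ($r\ge 0$) be monic polynomials with $f_1,\dots,f_r$ distinct and irreducible, and let $f=af_1\cdots f_r g^2$. Then the following are equivalent: (i) $f\in\langle D_{F(\boldsymbol{X})}^*(\varphi)\rangle$;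 (ii) $a\in\langle D_F^*(\varphi)\rangle$ and $f_k\in\langle D_{F(\boldsymbol{X})}^*(\varphi)\rangle$ for every $1\le k\le r$; (iii) $a\in\langle D_F^*(\varphi)\rangle$ and $\varphi_{F(f_k)}$ is isotropic for every $1\le k\le r$, i.e. $\varphi_{F(f_k)}(v)=0$ for some nonzero $v\in F(f_k)\otimes_F V$. -/

import Mathlib

open scoped TensorProduct

noncomputable section

namespace CharTwoForms

universe u v w

/-- `D(Q)`: the set of all scalars represented by the quadratic form `Q`, including `0`. -/
def represented {E : Type u} {W : Type v} [CommRing E] [AddCommGroup W] [Module E W]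
    (Q : QuadraticForm E W) : Set E :=
  Set.range fun x : W => Q x

/-- `D*(Q) = D(Q) \ {0}`. -/
def representedStar {E : Type u} {W : Type v} [CommRing E] [AddCommGroup W] [Module E W]
    (Q : QuadraticForm E W) : Set E :=
  represented Q \ {0}

/-- The subgroup of the multiplicative group of the field `E` generated by `D*(Q)`. -/
def representedGroup {E : Type u} {W : Type v} [Field E] [AddCommGroup W] [Module E W]
    (Q : QuadraticForm E W) : Subgroup Eˣ :=
  Subgroup.closure {y : Eˣ | (y : E) ∈ representedStar Q}

/-- A quadratic form is isotropic if it vanishes at a nonzero vector. -/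
def IsIsotropic {E : Type u} {W : Type v} [CommRing E] [AddCommGroup W] [Module E W]
    (Q : QuadraticForm E W) : Prop :=
  ∃ x : W, x ≠ 0 ∧ Q x = 0

/-- The quasilinear index (defect) of a quadratic form: the dimension of the space of all `x` in
the radical of the polar form with `Q x = 0`. This is the number `j` of summands `⟨0⟩` in a Witt
decomposition of `Q`, as `quasilinearIndex_of_witt_decomposition` shows. -/
def quasilinearIndex {F : Type u} {V : Type v} [Field F] [AddCommGroup V] [Module F V]
    (Q : QuadraticForm F V) : ℕ :=
  Module.finrank F Q.radical

/-- For a form `[a₁, b₁] ⊥ ⋯ ⊥ [a_r, b_r] ⊥ ⟨c₁, …, c_s⟩ ⊥ j × ⟨0⟩` with `⟨c₁, …, c_s⟩` anisotropic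
(hyperbolic planes being the summands `[0, 0]`), the quasilinear index is `j`. -/
theorem quasilinearIndex_of_witt_decomposition {F : Type u} [Field F] [CharP F 2] {r s j : ℕ}
    (a b : Fin r → F) (c : Fin s → F)
    (hc : ∀ z : Fin s → F, ∑ k, c k * z k ^ 2 = 0 → z = 0)
    (Q : QuadraticForm F ((Fin r → F × F) × (Fin s → F) × (Fin j → F)))
    (hQ : ∀ y z w, Q (y, z, w) =
      ∑ k, (a k * (y k).1 ^ 2 + (y k).1 * (y k).2 + b k * (y k).2 ^ 2) + ∑ k, c k * z k ^ 2) :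
    quasilinearIndex Q = j := by
  have h2 : (2 : F) = 0 := CharTwo.two_eq_zero
  have key : ∀ v, v ∈ Q.radical ↔ v.1 = 0 ∧ v.2.1 = 0 := by
    rintro ⟨y, z, w⟩
    rw [QuadraticMap.mem_radical_iff']
    constructor
    · rintro ⟨h0, h⟩
      have hy : y = 0 := by
        funext k
        have e1 := h (Pi.single k (1, 0), 0, 0)
        have e2 := h (Pi.single k (0, 1), 0, 0)
        simp [hQ, Pi.single_apply, add_mul, mul_add, add_sq, Finset.sum_add_distrib,
          apply_ite Prod.fst, apply_ite Prod.snd, h2] at e1 e2 h0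
        ext
        · simp only [Pi.zero_apply, Prod.fst_zero]
          linear_combination e2 - h0
        · simp only [Pi.zero_apply, Prod.snd_zero]
          linear_combination e1 - h0
      refine ⟨hy, hc z ?_⟩
      rw [hQ, hy] at h0
      simpa using h0
    · rintro ⟨hy, hz⟩
      simp only at hy hz
      subst hy hz
      refine ⟨by simp [hQ], ?_⟩
      rintro ⟨y', z', w'⟩
      simp [hQ]
  let e : (Fin j → F) ≃ₗ[F] Q.radical :=
    { toFun := fun w => ⟨(0, 0, w), (key _).2 ⟨rfl, rfl⟩⟩
      invFun := fun v => v.1.2.2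
      map_add' := fun _ _ => by ext <;> simp
      map_smul' := fun _ _ => by ext <;> simp
      left_inv := fun _ => rfl
      right_inv := fun v => by
        have h := (key _).1 v.2
        ext1
        exact Prod.ext h.1.symm (Prod.ext h.2.symm rfl) }
  rw [quasilinearIndex, ← e.finrank_eq]
  simp

/-- A quadratic form is nondefective if its quasilinear index is `0`. -/
def IsNondefective {F : Type u} {V : Type v} [Field F] [AddCommGroup V] [Module F V]
    (Q : QuadraticForm F V) : Prop :=
  quasilinearIndex Q = 0

/-- A bilinear form `B` with `B x x = φ x`, upper triangular for a chosen basis. -/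
def upperBilin {F : Type u} {V : Type v} [Field F] [AddCommGroup V] [Module F V]
    [FiniteDimensional F V] (φ : QuadraticForm F V) : LinearMap.BilinForm F V :=
  φ.toBilin (Module.finBasis F V)

/-- The scalar extension `φ_E` of `φ`, on `E ⊗ V`. Mathlib's `QuadraticForm.baseChange` needs `2`
to be invertible; by `extend_tmul` and `polar_extend_tmul`, this one is the usual scalar extension
(by `baseChange_ext` it is the only form with the first property), so it does not depend on the
chosen basis. -/
def extend {F : Type u} {V : Type v} [Field F] [AddCommGroup V] [Module F V]
    [FiniteDimensional F V] (E : Type w) [CommRing E] [Algebra F E] (φ : QuadraticForm F V) :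
    QuadraticForm E (E ⊗[F] V) :=
  LinearMap.BilinMap.toQuadraticMap (LinearMap.BilinForm.baseChange E (upperBilin φ))

theorem upperBilin_self {F : Type u} {V : Type v} [Field F] [AddCommGroup V] [Module F V]
    [FiniteDimensional F V] (φ : QuadraticForm F V) (x : V) : upperBilin φ x x = φ x := by
  have h := QuadraticMap.toQuadraticMap_toBilin φ (Module.finBasis F V)
  exact congrArg (fun q : QuadraticForm F V => q x) h

theorem extend_tmul {F : Type u} {V : Type v} [Field F] [AddCommGroup V] [Module F V]
    [FiniteDimensional F V] (E : Type w) [CommRing E] [Algebra F E] (φ : QuadraticForm F V)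
    (c : E) (x : V) : extend E φ (c ⊗ₜ[F] x) = c ^ 2 * algebraMap F E (φ x) := by
  simp [extend, upperBilin_self, Algebra.smul_def]
  ring

theorem polar_extend_tmul {F : Type u} {V : Type v} [Field F] [AddCommGroup V] [Module F V]
    [FiniteDimensional F V] (E : Type w) [CommRing E] [Algebra F E] (φ : QuadraticForm F V)
    (c d : E) (x y : V) :
    QuadraticMap.polar (extend E φ) (c ⊗ₜ[F] x) (d ⊗ₜ[F] y)
      = c * d * algebraMap F E (QuadraticMap.polar φ x y) := by
  have h : QuadraticMap.polar φ x y = upperBilin φ x y + upperBilin φ y x := by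
    simp only [QuadraticMap.polar, ← upperBilin_self, map_add, LinearMap.add_apply]
    ring
  rw [h, extend, LinearMap.BilinMap.polar_toQuadraticMap]
  simp [Algebra.smul_def]
  ring

/-- The field of rational functions `F(X₁, …, X_l)`. -/
abbrev RationalFunctionField (F : Type u) [Field F] (l : ℕ) : Type u :=
  FractionRing (MvPolynomial (Fin l) F)

/-- The function field `F(f)`: the quotient field of `F[X₁, …, X_l] / (f)`. It is a field when `f`
is irreducible. -/
abbrev FunctionField {F : Type u} [Field F] {l : ℕ} (f : MvPolynomial (Fin l) F) : Type u :=
  FractionRing (MvPolynomial (Fin l) F ⧸ Ideal.span {f})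

/-- A polynomial is monic if its leading coefficient with respect to the lexicographical ordering,
with `X₁ > X₂ > ⋯ > X_l`, is `1`. -/
def IsMonic {F : Type u} [Field F] {l : ℕ} (f : MvPolynomial (Fin l) F) : Prop :=
  (MonomialOrder.lex (σ := Fin l)).Monic f

/-- `f` lies in the subgroup of `F(X₁, …, X_l)*` generated by the nonzero values of `φ` over
`F(X₁, …, X_l)`. -/
def MemGroupOverRational {F : Type u} {V : Type v} [Field F] [AddCommGroup V] [Module F V]
    [FiniteDimensional F V] {l : ℕ} (φ : QuadraticForm F V) (f : MvPolynomial (Fin l) F) : Prop :=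
  ∃ y ∈ representedGroup (extend (RationalFunctionField F l) φ),
    (y : RationalFunctionField F l) = algebraMap (MvPolynomial (Fin l) F) _ f

end CharTwoForms

end

/-!
A nondefective isotropic form takes every value over every extension field of `F`, as
`φ (c • v + w) = c * b(v, w) + φ w` when `φ v = 0` and `b(v, w) ≠ 0`, so all three conditions hold
and the content lies in the anisotropic case. Writing `φ` in coordinates, one can work with vectors
over `F`-algebras `A` instead of their fraction fields: membership in the group generated by the
values becomes `IsValueProduct`, and isotropy over the fraction field of `A ⧸ (p)` becomes
`IsIsotropicMod`, which asks for a vector `x` over `A`, not divisible by `p`, with `p ∣ φ(x)`.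

If a product of values over a factorial ring has odd order at a prime `p`, then so has one of the
factors `φ(x)`; removing from `x` all factors `p` changes this order by an even number, so `φ` is
isotropic modulo `p` (`IsValueProduct.isIsotropicMod`). Distinct monic irreducible polynomials
`f₁, …, f_r` occur to an odd power in `a f₁ ⋯ f_r g²`, so `φ` is isotropic modulo each of them as
soon as this product lies in the group generated by the values.

Conversely, primes modulo which `φ` is isotropic are products of values up to units. This passes
from `A` to `A[X]` (`SatisfiesValueTheorem.polynomial`). For a nonconstant prime `p`,
pseudo-division yields a vector `x ≠ 0` of degree less than that of `p` with `φ(x) = p * h`;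
comparing degrees, `h` has smaller degree than `p`. Each prime with odd multiplicity in `h` has it
in the value `p * h` as well, so `φ` is isotropic modulo that prime, which by induction on the
degree is a product of values up to a unit. Hence so is `h`, and with it `p`.
Iterating over the variables, one may stay inside polynomial rings throughout.

Finally, the leading coefficient of a value of an anisotropic form is a value over `F`, because no
leading terms cancel (`IsAnisotropicOver.exists_leadingCoeff_coordForm`). For monic polynomials
this removes the ambiguity of the unit, and applied to `a f₁ ⋯ f_r g²` it shows that `a` is a
product of values over `F`.
-/

namespace CharTwoForms

/-! ### Quadratic forms in coordinates and products of their values -/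

section Coordinates

variable {F : Type*} [Field F] {ι : Type*} [Fintype ι] (c : ι → ι → F)

/-- The values of the quadratic form `∑ i j, c i j * x i * x j` on the vectors with entries in an
`F`-algebra `A`. Unlike `extend`, this makes sense in coordinates over any `F`-algebra, so that
reduction modulo a prime and clearing denominators become entrywise operations. -/
def coordForm {A : Type*} [CommRing A] [Algebra F A] (x : ι → A) : A :=
  ∑ i, ∑ j, algebraMap F A (c i j) * (x i * x j)

/-- The form with coefficients `c` has no nontrivial zero with entries in `A`. -/
def IsAnisotropicOver (A : Type*) [CommRing A] [Algebra F A] : Prop :=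
  ∀ x : ι → A, coordForm c x = 0 → x = 0

variable {A B : Type*} [CommRing A] [Algebra F A] [CommRing B] [Algebra F B]

theorem coordForm_map (e : A →ₐ[F] B) (x : ι → A) :
    coordForm c (fun i => e (x i)) = e (coordForm c x) := by
  simp [coordForm]

theorem coordForm_smul (s : A) (x : ι → A) :
    coordForm c (fun i => s * x i) = s ^ 2 * coordForm c x := by
  simp only [coordForm, Finset.mul_sum]
  refine Finset.sum_congr rfl fun i _ => Finset.sum_congr rfl fun j _ => by ring

@[simp]
theorem coordForm_zero : coordForm c (0 : ι → A) = 0 := by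
  simp [coordForm]

theorem IsAnisotropicOver.of_injective {e : A →ₐ[F] B} (he : Function.Injective e)
    (h : IsAnisotropicOver c B) : IsAnisotropicOver c A := by
  intro x hx
  have h1 := h (fun i => e (x i)) (by rw [coordForm_map, hx, map_zero])
  funext i
  exact he (by simpa using congrFun h1 i)

/-- The coefficient of a value `φ(x)` in twice a degree bounding all entries of `x` is the value of
`φ` at the vector of top coefficients. -/
theorem coeff_coordForm {x : ι → Polynomial A} {n : ℕ} (hx : ∀ i, (x i).natDegree ≤ n) :
    (coordForm c x).coeff (n + n) = coordForm c fun i => (x i).coeff n := by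
  simp only [coordForm, Polynomial.finsetSum_coeff]
  refine Finset.sum_congr rfl fun i _ => Finset.sum_congr rfl fun j _ => ?_
  rw [Polynomial.algebraMap_apply, Polynomial.coeff_C_mul,
    Polynomial.coeff_mul_add_eq_of_natDegree_le (hx i) (hx j)]

theorem natDegree_coordForm_le {x : ι → Polynomial A} {n : ℕ} (hx : ∀ i, (x i).natDegree ≤ n) :
    (coordForm c x).natDegree ≤ n + n := by
  refine Polynomial.natDegree_sum_le_of_forall_le _ _ fun i _ =>
    Polynomial.natDegree_sum_le_of_forall_le _ _ fun j _ => ?_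
  rw [Polynomial.algebraMap_apply]
  exact (Polynomial.natDegree_C_mul_le _ _).trans
    (Polynomial.natDegree_mul_le_of_le (hx i) (hx j))

theorem IsAnisotropicOver.polynomial (h : IsAnisotropicOver c A) :
    IsAnisotropicOver c (Polynomial A) := by
  intro x hx
  by_contra hne
  obtain ⟨i₀, hi₀⟩ := Function.ne_iff.1 hne
  obtain ⟨k, -, hk⟩ := Finset.exists_max_image Finset.univ (fun i => (x i).degree)
    ⟨i₀, Finset.mem_univ _⟩
  have hk0 : x k ≠ 0 := by
    intro h0
    have := hk i₀ (Finset.mem_univ _)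
    rw [h0, Polynomial.degree_zero, le_bot_iff, Polynomial.degree_eq_bot] at this
    exact hi₀ this
  have h1 := h _ ((coeff_coordForm c (n := (x k).natDegree) fun i =>
    Polynomial.natDegree_le_natDegree (hk i (Finset.mem_univ _))).symm.trans (by simp [hx]))
  exact hk0 (Polynomial.leadingCoeff_eq_zero.1 (congrFun h1 k))

/-- The form is isotropic modulo `p`: when `p` is prime this is isotropy over the fraction field of
`A ⧸ (p)`. -/
def IsIsotropicMod (p : A) : Prop :=
  ∃ x : ι → A, (∃ i, ¬ p ∣ x i) ∧ p ∣ coordForm c x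

variable (F) in
theorem mkₐ_span_singleton_eq_zero_iff (p y : A) :
    Ideal.Quotient.mkₐ F (Ideal.span {p}) y = 0 ↔ p ∣ y := by
  rw [Ideal.Quotient.mkₐ_eq_mk, Ideal.Quotient.eq_zero_iff_mem, Ideal.mem_span_singleton]

theorem isIsotropicMod_iff (p : A) :
    IsIsotropicMod c p ↔ ¬ IsAnisotropicOver c (A ⧸ Ideal.span {p}) := by
  have hdvd := mkₐ_span_singleton_eq_zero_iff F p
  constructor
  · rintro ⟨x, ⟨i, hi⟩, hx⟩ h
    have := h (fun i => Ideal.Quotient.mkₐ F (Ideal.span {p}) (x i))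
      (by rwa [coordForm_map, hdvd])
    exact hi ((hdvd _).1 (congrFun this i))
  · intro h
    simp only [IsAnisotropicOver, not_forall] at h
    obtain ⟨y, hy, hne⟩ := h
    choose x hx using fun i => Ideal.Quotient.mkₐ_surjective F (Ideal.span {p}) (y i)
    obtain rfl : (fun i => Ideal.Quotient.mkₐ F (Ideal.span {p}) (x i)) = y := funext hx
    rw [coordForm_map, hdvd] at hy
    obtain ⟨i, hi⟩ := Function.ne_iff.1 hne
    exact ⟨x, ⟨i, fun h => hi ((hdvd _).2 h)⟩, hy⟩

theorem IsIsotropicMod.map (e : A ≃ₐ[F] B) {p : A} (h : IsIsotropicMod c p) :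
    IsIsotropicMod c (e p) := by
  obtain ⟨x, ⟨i, hi⟩, hx⟩ := h
  exact ⟨fun i => e (x i), ⟨i, by rwa [map_dvd_iff]⟩,
    by rw [← AlgEquiv.coe_toAlgHom, coordForm_map, AlgEquiv.coe_toAlgHom, map_dvd_iff]; exact hx⟩

/-- Passing to a polynomial ring does not create isotropy modulo a constant `p`, since
`A[X] ⧸ (p)` is the polynomial ring over `A ⧸ (p)`. -/
theorem IsIsotropicMod.of_C {p : A} (h : IsIsotropicMod c (Polynomial.C p)) :
    IsIsotropicMod c p := by
  rw [isIsotropicMod_iff]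
  intro han
  obtain ⟨x, ⟨i, hi⟩, hx⟩ := h
  let e := Polynomial.mapAlgHom (Ideal.Quotient.mkₐ F (Ideal.span {p}))
  have he (y : Polynomial A) : e y = 0 ↔ Polynomial.C p ∣ y := by
    rw [Polynomial.C_dvd_iff_dvd_coeff, Polynomial.ext_iff]
    refine forall_congr' fun n => ?_
    simp [e, Ideal.Quotient.eq_zero_iff_mem, Ideal.mem_span_singleton]
  have := IsAnisotropicOver.polynomial c han (fun i => e (x i)) (by rwa [coordForm_map, he])
  exact hi ((he _).1 (congrFun this i))

variable (A) in
/-- The multiplicative monoid generated by the squares of `A` and the values of the form at vectors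
with entries in `A`. -/
def valueMonoid : Submonoid A :=
  Submonoid.closure ({s | IsSquare s} ∪ Set.range fun x : ι → A => coordForm c x)

/-- For a domain `A`, the nonzero elements of `A` that are, up to squares of nonzero elements, a
product of values of the form. If the form represents `1`, these are the elements of `A` in the
group generated by the nonzero values over the fraction field. -/
def IsValueProduct (a : A) : Prop :=
  a ≠ 0 ∧ ∃ h : A, h ≠ 0 ∧ a * h ^ 2 ∈ valueMonoid c A

theorem coordForm_mem_valueMonoid (x : ι → A) : coordForm c x ∈ valueMonoid c A :=
  Submonoid.subset_closure (Or.inr ⟨x, rfl⟩)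

theorem sq_mem_valueMonoid (s : A) : s ^ 2 ∈ valueMonoid c A :=
  Submonoid.subset_closure (Or.inl (IsSquare.sq s))

variable {c}

theorem isValueProduct_coordForm [Nontrivial A] {x : ι → A} (hx : coordForm c x ≠ 0) :
    IsValueProduct c (coordForm c x) :=
  ⟨hx, 1, one_ne_zero, by simpa using coordForm_mem_valueMonoid c x⟩

theorem isValueProduct_one [Nontrivial A] : IsValueProduct c (1 : A) :=
  ⟨one_ne_zero, 1, one_ne_zero, by simp [one_mem]⟩

theorem valueMonoid_map (e : A →ₐ[F] B) {a : A} (ha : a ∈ valueMonoid c A) :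
    e a ∈ valueMonoid c B := by
  suffices valueMonoid c A ≤ (valueMonoid c B).comap (e : A →* B) from this ha
  rw [valueMonoid, Submonoid.closure_le]
  rintro _ (⟨s, rfl⟩ | ⟨x, rfl⟩)
  · exact Submonoid.subset_closure (Or.inl ⟨e s, map_mul e s s⟩)
  · exact Submonoid.subset_closure (Or.inr ⟨fun i => e (x i), coordForm_map c e x⟩)

theorem IsValueProduct.map {e : A →ₐ[F] B} (he : Function.Injective e) {a : A}
    (ha : IsValueProduct c a) : IsValueProduct c (e a) := by
  obtain ⟨ha0, h, hh, hm⟩ := ha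
  refine ⟨(map_ne_zero_iff e he).2 ha0, e h, (map_ne_zero_iff e he).2 hh, ?_⟩
  simpa using valueMonoid_map e hm

variable [IsDomain A]

theorem IsValueProduct.mul {a b : A} (ha : IsValueProduct c a) (hb : IsValueProduct c b) :
    IsValueProduct c (a * b) := by
  obtain ⟨ha0, h, hh, hm⟩ := ha
  obtain ⟨hb0, k, hk, hn⟩ := hb
  refine ⟨mul_ne_zero ha0 hb0, h * k, mul_ne_zero hh hk, ?_⟩
  convert mul_mem hm hn using 1
  ring

theorem IsValueProduct.of_mul_sq {a s : A} (h : IsValueProduct c (a * s ^ 2)) :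
    IsValueProduct c a := by
  obtain ⟨h0, k, hk, hm⟩ := h
  have hs : s ≠ 0 := by rintro rfl; simp at h0
  refine ⟨left_ne_zero_of_mul h0, s * k, mul_ne_zero hs hk, ?_⟩
  convert hm using 1
  ring

theorem IsValueProduct.of_mul_left {a b : A} (ha : IsValueProduct c a)
    (hab : IsValueProduct c (a * b)) : IsValueProduct c b := by
  refine IsValueProduct.of_mul_sq (s := a) ?_
  convert ha.mul hab using 1
  ring

theorem IsValueProduct.mul_sq {a s : A} (hs : s ≠ 0) (ha : IsValueProduct c a) :
    IsValueProduct c (a * s ^ 2) := by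
  obtain ⟨ha0, h, hh, hm⟩ := ha
  refine ⟨mul_ne_zero ha0 (pow_ne_zero _ hs), h, hh, ?_⟩
  convert mul_mem hm (sq_mem_valueMonoid c s) using 1
  ring

end Coordinates

/-! ### Prime divisors of products of values in a factorial ring -/

section FactorialRing

variable {F : Type*} [Field F] {ι : Type*} [Fintype ι] {c : ι → ι → F}
variable {A : Type*} [CommRing A] [Algebra F A] [IsDomain A] [UniqueFactorizationMonoid A]

/-- If a value of the form has odd order at a prime `p`, divide the vector by its content at `p`:
the value at the primitive vector is still divisible by `p`. -/
theorem isIsotropicMod_of_odd_coordForm {p : A} (hp : Prime p) {x : ι → A}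
    (hx : coordForm c x ≠ 0) (hodd : Odd (multiplicity p (coordForm c x))) :
    IsIsotropicMod c p := by
  -- Strong induction on the order of the value stands in for the content of the vector.
  induction hn : multiplicity p (coordForm c x) using Nat.strong_induction_on generalizing x with
  | _ n ih =>
    by_cases hd : ∀ i, p ∣ x i
    · choose y hy using hd
      obtain rfl : (fun i => p * y i) = x := funext fun i => (hy i).symm
      rw [coordForm_smul] at hx hodd hn
      have hm : multiplicity p (p ^ 2 * coordForm c y) = 2 + multiplicity p (coordForm c y) := by
        rw [multiplicity_mul hp (FiniteMultiplicity.of_prime_left hp hx),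
          multiplicity_pow_self_of_prime hp]
      rw [hm] at hodd hn
      refine ih _ (by omega) (right_ne_zero_of_mul hx) ?_ rfl
      rwa [add_comm, Nat.odd_add, iff_true_right even_two] at hodd
    · exact ⟨x, not_forall.1 hd, dvd_of_multiplicity_pos hodd.pos⟩

theorem multiplicity_mul_self_even {p s : A} (hp : Prime p) (hs : s ≠ 0) :
    Even (multiplicity p (s * s)) := by
  rw [multiplicity_mul hp (FiniteMultiplicity.of_prime_left hp (mul_ne_zero hs hs))]
  exact ⟨_, rfl⟩

/-- The easy half of the value theorem: the form is isotropic modulo each prime that divides a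
product of values to an odd power. -/
theorem IsValueProduct.isIsotropicMod {a p : A} (ha : IsValueProduct c a) (hp : Prime p)
    (hodd : Odd (multiplicity p a)) : IsIsotropicMod c p := by
  have key : ∀ b ∈ valueMonoid c A, b ≠ 0 → Odd (multiplicity p b) → IsIsotropicMod c p := by
    intro b hb
    induction hb using Submonoid.closure_induction with
    | mem b hb =>
      rcases hb with ⟨s, rfl⟩ | ⟨x, rfl⟩
      · intro hs ho
        exact absurd (multiplicity_mul_self_even hp (left_ne_zero_of_mul hs))
          (Nat.not_even_iff_odd.2 ho)
      · exact isIsotropicMod_of_odd_coordForm hp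
    | one =>
      intro _ ho
      rw [(FiniteMultiplicity.of_prime_left hp one_ne_zero).one_right] at ho
      exact absurd ho (by decide)
    | mul a b _ _ iha ihb =>
      intro h0 ho
      rw [multiplicity_mul hp (FiniteMultiplicity.of_prime_left hp h0), Nat.odd_add] at ho
      by_cases hA : Odd (multiplicity p a)
      · exact iha (left_ne_zero_of_mul h0) hA
      · exact ihb (right_ne_zero_of_mul h0) (Nat.not_even_iff_odd.1 fun h => hA (ho.2 h))
  obtain ⟨ha0, h, hh, hm⟩ := ha
  have h0 := mul_ne_zero ha0 (pow_ne_zero 2 hh)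
  refine key _ hm h0 ?_
  rw [multiplicity_mul hp (FiniteMultiplicity.of_prime_left hp h0), sq, Nat.odd_add,
    iff_true_right (multiplicity_mul_self_even hp hh)]
  exact hodd

/-- An element is a product of values up to a unit as soon as its prime divisors of odd
multiplicity are. -/
theorem exists_unit_isValueProduct {a : A} (ha : a ≠ 0)
    (h : ∀ q : A, Prime q → Odd (multiplicity q a) → ∃ u : Aˣ, IsValueProduct c (u * q)) :
    ∃ u : Aˣ, IsValueProduct c (u * a) := by
  induction a using UniqueFactorizationMonoid.induction_on_coprime with
  | h0 => exact absurd rfl ha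
  | h1 hx =>
    obtain ⟨v, rfl⟩ := hx
    exact ⟨v⁻¹, by simpa using isValueProduct_one⟩
  | hpr i hp =>
    rename_i p
    rcases Nat.even_or_odd' i with ⟨k, rfl | rfl⟩
    · refine ⟨1, ?_⟩
      convert isValueProduct_one.mul_sq (c := c) (pow_ne_zero k hp.ne_zero) using 1
      rw [Units.val_one]; ring
    · obtain ⟨u, hu⟩ := h p hp (by rw [multiplicity_pow_self_of_prime hp]; exact ⟨k, rfl⟩)
      refine ⟨u, ?_⟩
      convert hu.mul_sq (pow_ne_zero k hp.ne_zero) using 1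
      ring
  | hcp hxy ihx ihy =>
    rename_i x y
    have hx := left_ne_zero_of_mul ha
    have hy := right_ne_zero_of_mul ha
    have hm (q : A) (hq : Prime q) :
        multiplicity q (x * y) = multiplicity q x + multiplicity q y :=
      multiplicity_mul hq (FiniteMultiplicity.of_prime_left hq ha)
    -- A prime dividing one of two coprime factors does not divide the other.
    have hzero (q : A) (hq : Prime q) : multiplicity q x = 0 ∨ multiplicity q y = 0 := by
      by_contra! hcon
      exact hq.not_isUnit (hxy (dvd_of_multiplicity_pos (Nat.pos_of_ne_zero hcon.1))
        (dvd_of_multiplicity_pos (Nat.pos_of_ne_zero hcon.2)))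
    obtain ⟨u, hu⟩ := ihx hx fun q hq ho => h q hq (by
      rcases hzero q hq with h0 | h0
      · rw [h0] at ho; exact absurd ho (by decide)
      · rwa [hm q hq, h0])
    obtain ⟨v, hv⟩ := ihy hy fun q hq ho => h q hq (by
      rcases hzero q hq with h0 | h0
      · rwa [hm q hq, h0, zero_add]
      · rw [h0] at ho; exact absurd ho (by decide))
    refine ⟨u * v, ?_⟩
    convert hu.mul hv using 1
    rw [Units.val_mul]; ring

variable (c A) in
/-- Over the factorial ring `A`, isotropy modulo a prime makes the prime a product of values, up
to a unit. -/
def SatisfiesValueTheorem : Prop :=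
  ∀ p : A, Prime p → IsIsotropicMod c p → ∃ u : Aˣ, IsValueProduct c (u * p)

end FactorialRing

/-! ### The value theorem for polynomial rings in one variable -/

section Polynomial

/-- Pseudo-division: after multiplication by a power of the leading coefficient, division with
remainder by `p` is possible over any commutative ring. -/
theorem exists_natDegree_leadingCoeff_pow_mul_sub_lt {A : Type*} [CommRing A] {p : Polynomial A}
    (hp : 0 < p.natDegree) (n : ℕ) (f : Polynomial A) (hf : f.natDegree < n + p.natDegree) :
    ∃ q, (Polynomial.C (p.leadingCoeff ^ n) * f - p * q).natDegree < p.natDegree := by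
  induction n generalizing f with
  | zero => exact ⟨0, by simpa using hf⟩
  | succ n ih =>
    set d := p.natDegree with hd
    set g := Polynomial.C p.leadingCoeff * f -
      p * (Polynomial.C (f.coeff (n + d)) * Polynomial.X ^ n) with hg
    have hcoeff (m : ℕ) (hm : n + d ≤ m) : g.coeff m = 0 := by
      rw [hg, Polynomial.coeff_sub, Polynomial.coeff_C_mul, ← mul_assoc,
        Polynomial.coeff_mul_X_pow', if_pos (by omega), Polynomial.coeff_mul_C]
      rcases hm.eq_or_lt with rfl | hlt
      · rw [Nat.add_sub_cancel_left, hd, Polynomial.coeff_natDegree]; ring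
      · rw [Polynomial.coeff_eq_zero_of_natDegree_lt (p := f) (by omega),
          Polynomial.coeff_eq_zero_of_natDegree_lt (p := p) (by omega)]
        ring
    obtain ⟨q, hq⟩ := ih g (by
      by_contra! hcon
      have h0 := hcoeff _ hcon
      rw [Polynomial.coeff_natDegree, Polynomial.leadingCoeff_eq_zero] at h0
      rw [h0, Polynomial.natDegree_zero] at hcon
      omega)
    refine ⟨Polynomial.C (p.leadingCoeff ^ n) *
      (Polynomial.C (f.coeff (n + d)) * Polynomial.X ^ n) + q, ?_⟩
    convert hq using 2
    rw [hg, pow_succ, Polynomial.C_mul]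
    ring

variable {F : Type*} [Field F] {ι : Type*} [Fintype ι] {c : ι → ι → F}
variable {A : Type*} [CommRing A] [Algebra F A] [IsDomain A]

/-- The vectors showing that the form is isotropic modulo a nonconstant prime `p` of `A[X]` can be
chosen of degree less than that of `p`. -/
theorem IsIsotropicMod.exists_natDegree_lt {p : Polynomial A} (hp : Prime p)
    (hdeg : 0 < p.natDegree) (h : IsIsotropicMod c p) :
    ∃ x : ι → Polynomial A, x ≠ 0 ∧ (∀ i, (x i).natDegree < p.natDegree) ∧
      p ∣ coordForm c x := by
  obtain ⟨x, ⟨i, hi⟩, hx⟩ := h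
  set n := ∑ j, ((x j).natDegree + 1)
  choose q hq using fun j => exists_natDegree_leadingCoeff_pow_mul_sub_lt hdeg n (x j) (by
    have : (x j).natDegree + 1 ≤ n :=
      Finset.single_le_sum (f := fun j => (x j).natDegree + 1) (fun _ _ => Nat.zero_le _)
        (Finset.mem_univ j)
    omega)
  set s := Polynomial.C (p.leadingCoeff ^ n) with hs
  have hps : ¬ p ∣ s := by
    intro hd
    have hs0 : s ≠ 0 := Polynomial.C_ne_zero.2
      (pow_ne_zero _ (Polynomial.leadingCoeff_ne_zero.2 hp.ne_zero))
    have := Polynomial.natDegree_le_of_dvd hd hs0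
    rw [hs, Polynomial.natDegree_C] at this
    omega
  refine ⟨fun j => s * x j - p * q j, fun h0 => ?_, hq, ?_⟩
  · have h1 : p ∣ s * x i := ⟨q i, sub_eq_zero.1 (congrFun h0 i)⟩
    exact (hp.dvd_or_dvd h1).elim hps hi
  · have hmk := mkₐ_span_singleton_eq_zero_iff F p
    have h1 : p ∣ coordForm c fun j => s * x j := by
      rw [coordForm_smul]; exact hx.mul_left _
    rw [← hmk, ← coordForm_map] at h1 ⊢
    rw [← h1]
    congr 1
    funext j
    rw [map_sub, (hmk _).2 (dvd_mul_right p (q j)), sub_zero]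

variable [UniqueFactorizationMonoid A]

/-- Induction on the degree of the prime `p`: if `φ(x) = p * h` with `x ≠ 0` of degree less than
that of `p`, then `h` has smaller degree than `p`, and the form is isotropic modulo each prime that
divides `h` to an odd power. -/
theorem SatisfiesValueTheorem.polynomial (han : IsAnisotropicOver c A)
    (h : SatisfiesValueTheorem c A) : SatisfiesValueTheorem c (Polynomial A) := by
  intro p
  induction hn : p.natDegree using Nat.strong_induction_on generalizing p with
  | _ n ih =>
  intro hp hiso
  rcases Nat.eq_zero_or_pos n with rfl | hpos
  · rw [Polynomial.natDegree_eq_zero] at hn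
    obtain ⟨p, rfl⟩ := hn
    obtain ⟨u, hu⟩ := h p (Polynomial.prime_C_iff.1 hp) hiso.of_C
    refine ⟨Units.map (Polynomial.C : A →+* Polynomial A) u, ?_⟩
    simpa using hu.map (e := Polynomial.CAlgHom) (B := Polynomial A) Polynomial.C_injective
  · obtain ⟨x, hx0, hxdeg, hdvd⟩ := hiso.exists_natDegree_lt hp (by omega)
    obtain ⟨k, hk⟩ := hdvd
    have hval : coordForm c x ≠ 0 := fun h0 => hx0 (han.polynomial c x h0)
    have hk0 : k ≠ 0 := by rintro rfl; exact hval (by rw [hk, mul_zero])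
    have hkdeg : k.natDegree < n := by
      have h1 := natDegree_coordForm_le c (x := x) (n := n - 1) fun i => by
        have := hxdeg i; omega
      rw [hk, Polynomial.natDegree_mul hp.ne_zero hk0] at h1
      omega
    have hpk : IsValueProduct c (p * k) := hk ▸ isValueProduct_coordForm hval
    obtain ⟨u, hu⟩ := exists_unit_isValueProduct (c := c) hk0 (by
      intro q hq hodd
      have hqk : q ∣ k := dvd_of_multiplicity_pos hodd.pos
      have hqdeg : q.natDegree < n := (Polynomial.natDegree_le_of_dvd hqk hk0).trans_lt hkdeg
      refine ih _ hqdeg q rfl hq (hpk.isIsotropicMod hq ?_)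
      rw [multiplicity_mul hq (FiniteMultiplicity.of_prime_left hq (mul_ne_zero hp.ne_zero hk0)),
        multiplicity_eq_zero.2, zero_add]
      · exact hodd
      · intro hqp
        have := Polynomial.natDegree_le_of_dvd
          ((hq.irreducible.dvd_symm hp.irreducible) hqp) hq.ne_zero
        omega)
    refine ⟨u⁻¹, hu.of_mul_left ?_⟩
    convert hpk using 1
    linear_combination p * k * u.mul_inv

end Polynomial

/-! ### The value theorem for polynomial rings in several variables -/

section MvPolynomial

variable {F : Type*} [Field F] {ι : Type*} [Fintype ι] {c : ι → ι → F}

theorem SatisfiesValueTheorem.of_algEquiv {A B : Type*} [CommRing A] [Algebra F A]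
    [CommRing B] [Algebra F B] (e : A ≃ₐ[F] B)
    (h : SatisfiesValueTheorem c A) : SatisfiesValueTheorem c B := by
  intro p hp hiso
  obtain ⟨u, hu⟩ := h (e.symm p) ((MulEquiv.prime_iff e.symm).2 hp) (hiso.map c e.symm)
  refine ⟨Units.map (e : A →* B) u, ?_⟩
  simpa using hu.map (e := e.toAlgHom) e.injective

theorem IsAnisotropicOver.mvPolynomial (h : IsAnisotropicOver c F) (l : ℕ) :
    IsAnisotropicOver c (MvPolynomial (Fin l) F) := by
  induction l with
  | zero =>
    exact h.of_injective c (e := (MvPolynomial.isEmptyAlgEquiv F (Fin 0)).toAlgHom)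
      (AlgEquiv.injective _)
  | succ l ih =>
    exact (ih.polynomial c).of_injective c (e := (MvPolynomial.finSuccEquiv F l).toAlgHom)
      (AlgEquiv.injective _)

theorem IsAnisotropicOver.satisfiesValueTheorem (h : IsAnisotropicOver c F) (l : ℕ) :
    SatisfiesValueTheorem c (MvPolynomial (Fin l) F) := by
  induction l with
  | zero =>
    have h0 : SatisfiesValueTheorem c F := fun p hp => absurd hp.ne_zero.isUnit hp.not_isUnit
    exact h0.of_algEquiv (MvPolynomial.isEmptyAlgEquiv F (Fin 0)).symm
  | succ l ih =>
    exact (ih.polynomial (h.mvPolynomial l)).of_algEquiv (MvPolynomial.finSuccEquiv F l).symm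

end MvPolynomial

/-! ### Leading coefficients for a monomial order -/

section LeadingCoefficient

variable {F : Type*} [Field F] {ι : Type*} [Fintype ι] {c : ι → ι → F}
variable {σ : Type*} (m : MonomialOrder σ)

/-- For an anisotropic form, no cancellation occurs among leading terms: the leading coefficient of
a value over the polynomial ring is a value over `F`. -/
theorem IsAnisotropicOver.exists_leadingCoeff_coordForm (han : IsAnisotropicOver c F)
    (x : ι → MvPolynomial σ F) : ∃ y : ι → F, m.leadingCoeff (coordForm c x) = coordForm c y := by
  by_cases hx : x = 0
  · exact ⟨0, by simp [hx]⟩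
  obtain ⟨i₀, hi₀⟩ := Function.ne_iff.1 hx
  classical
  obtain ⟨k, hk0, hk⟩ := Finset.exists_max_image (Finset.univ.filter fun i => x i ≠ 0)
    (fun i => m.toSyn (m.degree (x i))) ⟨i₀, by simpa using hi₀⟩
  replace hk0 : x k ≠ 0 := by simpa using hk0
  set d := m.degree (x k) with hd
  have hle (i : ι) : m.toSyn (m.degree (x i)) ≤ m.toSyn d := by
    by_cases h0 : x i = 0
    · simp [h0]
    · exact hk i (by simpa using h0)
  have hcoeff : (coordForm c x).coeff (d + d) = coordForm c fun i => (x i).coeff d := by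
    simp only [coordForm, MvPolynomial.coeff_sum]
    refine Finset.sum_congr rfl fun i _ => Finset.sum_congr rfl fun j _ => ?_
    rw [MvPolynomial.algebraMap_eq, MvPolynomial.coeff_C_mul,
      m.coeff_mul_of_add_of_degree_le (hle i) (hle j), Algebra.algebraMap_self_apply]
  have hne : (coordForm c x).coeff (d + d) ≠ 0 := by
    rw [hcoeff]
    intro h0
    exact m.coeff_degree_ne_zero_iff.2 hk0 (congrFun (han _ h0) k)
  have hdeg : m.toSyn (m.degree (coordForm c x)) ≤ m.toSyn (d + d) := by
    refine m.degree_sum_le.trans (Finset.sup_le fun i _ => ?_)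
    refine m.degree_sum_le.trans (Finset.sup_le fun j _ => ?_)
    rw [MvPolynomial.algebraMap_eq, MvPolynomial.C_mul']
    refine m.degree_smul_le.trans (m.degree_mul_le.trans ?_)
    rw [map_add, map_add]
    exact add_le_add (hle i) (hle j)
  have heq : m.degree (coordForm c x) = d + d :=
    m.toSyn.injective (hdeg.antisymm (m.le_degree (MvPolynomial.mem_support_iff.2 hne)))
  exact ⟨_, by rw [MonomialOrder.leadingCoeff, heq, hcoeff]⟩

theorem IsValueProduct.leadingCoeff (han : IsAnisotropicOver c F) {f : MvPolynomial σ F}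
    (hf : IsValueProduct c f) : IsValueProduct c (m.leadingCoeff f) := by
  have key : ∀ b ∈ valueMonoid c (MvPolynomial σ F), m.leadingCoeff b ∈ valueMonoid c F := by
    intro b hb
    induction hb using Submonoid.closure_induction with
    | mem b hb =>
      rcases hb with ⟨s, rfl⟩ | ⟨x, rfl⟩
      · rw [m.leadingCoeff_mul, ← sq]
        exact sq_mem_valueMonoid c _
      · obtain ⟨y, hy⟩ := han.exists_leadingCoeff_coordForm m x
        rw [hy]
        exact coordForm_mem_valueMonoid c y
    | one => rw [m.leadingCoeff_one]; exact one_mem _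
    | mul a b _ _ iha ihb => rw [m.leadingCoeff_mul]; exact mul_mem iha ihb
  obtain ⟨hf0, h, hh, hm⟩ := hf
  refine ⟨m.leadingCoeff_ne_zero_iff.2 hf0, m.leadingCoeff h, m.leadingCoeff_ne_zero_iff.2 hh, ?_⟩
  simpa [sq] using key _ hm

theorem IsValueProduct.mvPolynomial_C {a : F} (ha : IsValueProduct c a) :
    IsValueProduct c (MvPolynomial.C a : MvPolynomial σ F) :=
  ha.map (e := Algebra.ofId F (MvPolynomial σ F)) (MvPolynomial.C_injective σ F)

/-- A monic polynomial leaves no freedom for the unit: comparing leading coefficients shows the unit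
itself to be a product of values over `F`. -/
theorem IsValueProduct.of_unit_mul_monic (han : IsAnisotropicOver c F)
    {u : (MvPolynomial σ F)ˣ} {f : MvPolynomial σ F} (hf : m.Monic f)
    (h : IsValueProduct c (u * f)) : IsValueProduct c f := by
  obtain ⟨a, -, ha⟩ := MvPolynomial.isUnit_iff_eq_C_of_isReduced.1 u.isUnit
  rw [ha] at h
  have h1 := h.leadingCoeff m han
  rw [m.leadingCoeff_mul, hf.leadingCoeff_eq_one, m.leadingCoeff_C, mul_one] at h1
  exact h1.mvPolynomial_C.of_mul_left h

theorem odd_multiplicity_C_mul_prod {r : ℕ} {a : F} (ha : a ≠ 0) {f : Fin r → MvPolynomial σ F}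
    (hmonic : ∀ k, m.Monic (f k)) (hinj : Function.Injective f) (hirr : ∀ k, Irreducible (f k))
    (k : Fin r) : Odd (multiplicity (f k) (MvPolynomial.C a * ∏ j, f j)) := by
  have hp := (hirr k).prime
  have h0 : MvPolynomial.C a * ∏ j, f j ≠ 0 :=
    mul_ne_zero (by simpa using ha) (Finset.prod_ne_zero_iff.2 fun j _ => (hirr j).ne_zero)
  rw [← Finset.mul_prod_erase _ _ (Finset.mem_univ k), mul_left_comm] at h0 ⊢
  have hnd : ¬ f k ∣ MvPolynomial.C a * ∏ j ∈ Finset.univ.erase k, f j := by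
    rw [hp.dvd_mul, hp.dvd_finsetProd_iff]
    rintro (hd | ⟨j, hj, hd⟩)
    · exact hp.not_isUnit (isUnit_of_dvd_unit hd (ha.isUnit.map MvPolynomial.C))
    · -- Associated monic polynomials coincide.
      obtain ⟨u, hu⟩ := (hirr k).associated_of_dvd (hirr j) hd
      obtain ⟨b, -, hb⟩ := MvPolynomial.isUnit_iff_eq_C_of_isReduced.1 u.isUnit
      have h1 := congrArg m.leadingCoeff hu
      rw [hb, m.leadingCoeff_mul, (hmonic k).leadingCoeff_eq_one,
        (hmonic j).leadingCoeff_eq_one, m.leadingCoeff_C, one_mul] at h1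
      rw [hb, h1, map_one, mul_one] at hu
      exact Finset.ne_of_mem_erase hj (hinj hu.symm)
  rw [multiplicity_mul hp (FiniteMultiplicity.of_prime_left hp h0), multiplicity_eq_zero.2 hnd,
    multiplicity_self]
  exact odd_one

end LeadingCoefficient

/-! ### Fraction fields -/

section Fractions

theorem coordForm_algebraMap {ι F A K : Type*} [Fintype ι] [Field F] [CommRing A] [CommRing K]
    [Algebra F A] [Algebra F K] [Algebra A K] [IsScalarTower F A K] {c : ι → ι → F} (x : ι → A) :
    coordForm c (fun i => algebraMap A K (x i)) = algebraMap A K (coordForm c x) :=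
  coordForm_map c (IsScalarTower.toAlgHom F A K) x

variable {F : Type*} [Field F] {ι : Type*} [Fintype ι] {c : ι → ι → F}
variable {A : Type*} [CommRing A] [IsDomain A] [Algebra F A]
variable {K : Type*} [Field K] [Algebra A K] [Algebra F K] [IsScalarTower F A K]
  [IsFractionRing A K]

variable (A) in
/-- Clearing denominators in a vector over the fraction field. -/
theorem exists_smul_eq_algebraMap (x : ι → K) : ∃ s : A, s ≠ 0 ∧ ∃ y : ι → A,
    ∀ i, algebraMap A K (y i) = algebraMap A K s * x i := by
  obtain ⟨s, hs⟩ := IsLocalization.exist_integer_multiples_of_finite (nonZeroDivisors A) x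
  choose y hy using hs
  exact ⟨s, nonZeroDivisors.coe_ne_zero s, y, fun i => by rw [hy, Algebra.smul_def]⟩

theorem isAnisotropicOver_fractionRing_iff :
    IsAnisotropicOver c K ↔ IsAnisotropicOver c A := by
  refine ⟨fun h => h.of_injective c (e := IsScalarTower.toAlgHom F A K)
    (IsFractionRing.injective A K), fun h x hx => ?_⟩
  obtain ⟨s, hs, y, hy⟩ := exists_smul_eq_algebraMap A x
  have hy0 : y = 0 := by
    refine h y (IsFractionRing.injective A K ?_)
    rw [← coordForm_algebraMap, funext hy, coordForm_smul, hx, mul_zero, map_zero]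
  funext i
  have h1 := hy i
  rw [hy0, Pi.zero_apply, map_zero] at h1
  exact (mul_eq_zero.1 h1.symm).resolve_left
    ((map_ne_zero_iff _ (IsFractionRing.injective A K)).2 hs)

variable {W : Type*} [AddCommGroup W] [Module K W]

theorem exists_mem_representedGroup_iff {Q : QuadraticForm K W}
    (hQ : represented Q = Set.range fun x : ι → K => coordForm c x)
    {e : ι → F} (he : coordForm c e = 1) (a : A) :
    (∃ y ∈ representedGroup Q, (y : K) = algebraMap A K a) ↔ IsValueProduct c a := by
  have hinj := IsFractionRing.injective A K
  constructor
  · rintro ⟨y, hy, hya⟩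
    suffices ∃ b s : A, IsValueProduct c b ∧ s ≠ 0 ∧
        (y : K) * algebraMap A K s ^ 2 = algebraMap A K b by
      obtain ⟨b, s, hb, hs, h⟩ := this
      rw [hya, ← map_pow, ← map_mul] at h
      exact IsValueProduct.of_mul_sq (s := s) (hinj h ▸ hb)
    clear hya
    induction hy using Subgroup.closure_induction with
    | mem y hy =>
      have hy1 := hy.1
      rw [hQ] at hy1
      obtain ⟨x, hx⟩ := hy1
      obtain ⟨s, hs, z, hz⟩ := exists_smul_eq_algebraMap A x
      have hval : (y : K) * algebraMap A K s ^ 2 = algebraMap A K (coordForm c z) := by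
        rw [← coordForm_algebraMap, funext hz, coordForm_smul, ← hx, mul_comm]
      refine ⟨_, s, isValueProduct_coordForm fun h0 => ?_, hs, hval⟩
      rw [h0, map_zero] at hval
      exact mul_ne_zero y.ne_zero (pow_ne_zero 2 ((map_ne_zero_iff _ hinj).2 hs)) hval
    | one => exact ⟨1, 1, isValueProduct_one, one_ne_zero, by simp⟩
    | mul y z _ _ ihy ihz =>
      obtain ⟨b, s, hb, hs, h⟩ := ihy
      obtain ⟨b', s', hb', hs', h'⟩ := ihz
      refine ⟨b * b', s * s', hb.mul hb', mul_ne_zero hs hs', ?_⟩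
      rw [map_mul, map_mul, ← h, ← h', Units.val_mul]
      ring
    | inv y _ ih =>
      -- If `y * s ^ 2 = b`, then `y⁻¹ * b ^ 2 = b * s ^ 2`.
      obtain ⟨b, s, hb, hs, h⟩ := ih
      refine ⟨b * s ^ 2, b, hb.mul_sq hs, hb.1, ?_⟩
      rw [map_mul, map_pow, ← h, Units.val_inv_eq_inv_val]
      field_simp
  · rintro ⟨ha0, h, hh, hm⟩
    have hval (x : ι → K) (z : Kˣ) (hz : (z : K) = coordForm c x) : z ∈ representedGroup Q :=
      Subgroup.subset_closure ⟨by rw [hQ]; exact ⟨x, hz.symm⟩, z.ne_zero⟩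
    have hsq (s : K) (z : Kˣ) (hz : (z : K) = s ^ 2) : z ∈ representedGroup Q := by
      refine hval (fun i => s * algebraMap F K (e i)) z ?_
      have h1 : coordForm c (fun i => algebraMap F K (e i)) = 1 := by
        have := coordForm_map c (Algebra.ofId F K) e
        rwa [he, map_one] at this
      rw [coordForm_smul, h1, mul_one, hz]
    have key : ∀ b ∈ valueMonoid c A, ∀ z : Kˣ, (z : K) = algebraMap A K b →
        z ∈ representedGroup Q := by
      intro b hb
      induction hb using Submonoid.closure_induction with
      | mem b hb =>
        intro z hz
        rcases hb with ⟨s, rfl⟩ | ⟨x, rfl⟩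
        · exact hsq (algebraMap A K s) z (by rw [hz, map_mul, sq])
        · exact hval (fun i => algebraMap A K (x i)) z (by rw [hz, coordForm_algebraMap])
      | one =>
        intro z hz
        obtain rfl : z = 1 := Units.ext (by simpa using hz)
        exact one_mem _
      | mul a b _ _ iha ihb =>
        intro z hz
        rw [map_mul] at hz
        have hne : algebraMap A K a * algebraMap A K b ≠ 0 := hz ▸ z.ne_zero
        have h1 := iha (Units.mk0 _ (left_ne_zero_of_mul hne)) rfl
        have h2 := ihb (Units.mk0 _ (right_ne_zero_of_mul hne)) rfl
        convert mul_mem h1 h2 using 1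
        exact Units.ext hz
    have ha' := (map_ne_zero_iff (algebraMap A K) hinj).2 ha0
    have hh' := (map_ne_zero_iff (algebraMap A K) hinj).2 hh
    refine ⟨Units.mk0 _ ha', ?_, rfl⟩
    have h1 := hsq (algebraMap A K h) (Units.mk0 _ (pow_ne_zero 2 hh')) rfl
    refine ((representedGroup Q).mul_mem_cancel_right h1).1 (key _ hm _ ?_)
    simp

end Fractions

/-! ### From quadratic forms to coordinates -/

section QuadraticForm

theorem representedGroup_eq_top {K W : Type*} [Field K] [AddCommGroup W] [Module K W]
    {Q : QuadraticForm K W} {v w : W} (hv : Q v = 0) (hvw : QuadraticMap.polar Q v w ≠ 0) :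
    representedGroup Q = ⊤ := by
  rw [eq_top_iff]
  intro y _
  refine Subgroup.subset_closure
    ⟨⟨(((y : K) - Q w) / QuadraticMap.polar Q v w) • v + w, ?_⟩, y.ne_zero⟩
  simp only [QuadraticMap.map_add, QuadraticMap.map_smul, hv, QuadraticMap.polar_smul_left,
    smul_eq_mul]
  field_simp
  ring

variable {F : Type*} [Field F] {V : Type*} [AddCommGroup V] [Module F V] [FiniteDimensional F V]

/-- The coefficients of `φ` in the basis underlying `upperBilin φ`. -/
noncomputable def formCoeff (φ : QuadraticForm F V) (i j : Fin (Module.finrank F V)) : F :=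
  upperBilin φ (Module.finBasis F V i) (Module.finBasis F V j)

variable (φ : QuadraticForm F V)

theorem apply_eq_coordForm (x : V) :
    φ x = coordForm (formCoeff φ) ((Module.finBasis F V).repr x) := by
  rw [← upperBilin_self, ← LinearMap.sum_repr_mul_repr_mul (Module.finBasis F V)
    (Module.finBasis F V) x x]
  simp only [coordForm, formCoeff, Finsupp.sum_fintype, smul_eq_mul, zero_mul, mul_zero,
    Finset.sum_const_zero, implies_true, Algebra.algebraMap_self_apply]
  refine Finset.sum_congr rfl fun i _ => Finset.sum_congr rfl fun j _ => by ring

theorem extend_apply_eq_coordForm (E : Type*) [CommRing E] [Algebra F E] (x : E ⊗[F] V) :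
    extend E φ x = coordForm (formCoeff φ)
      ((Algebra.TensorProduct.basis E (Module.finBasis F V)).repr x) := by
  set b := Algebra.TensorProduct.basis E (Module.finBasis F V) with hb
  rw [extend, LinearMap.BilinMap.toQuadraticMap_apply,
    ← LinearMap.sum_repr_mul_repr_mul b b x x]
  simp only [coordForm, formCoeff, Finsupp.sum_fintype, smul_eq_mul, zero_mul, mul_zero,
    Finset.sum_const_zero, implies_true]
  refine Finset.sum_congr rfl fun i _ => Finset.sum_congr rfl fun j _ => ?_
  rw [hb, Algebra.TensorProduct.basis_apply, Algebra.TensorProduct.basis_apply,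
    LinearMap.BilinForm.baseChange_tmul, Algebra.smul_def]
  ring

theorem represented_eq_range_coordForm :
    represented φ = Set.range fun x : _ → F => coordForm (formCoeff φ) x := by
  rw [represented, funext (apply_eq_coordForm φ)]
  exact (Module.finBasis F V).equivFun.surjective.range_comp (coordForm (formCoeff φ))

theorem represented_extend_eq_range_coordForm (E : Type*) [CommRing E] [Algebra F E] :
    represented (extend E φ) = Set.range fun x : _ → E => coordForm (formCoeff φ) x := by
  rw [represented, funext (extend_apply_eq_coordForm φ E)]
  exact (Algebra.TensorProduct.basis E (Module.finBasis F V)).equivFun.surjective.range_comp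
    (coordForm (formCoeff φ))

theorem isIsotropic_extend_iff (E : Type*) [CommRing E] [Algebra F E] :
    IsIsotropic (extend E φ) ↔ ¬ IsAnisotropicOver (formCoeff φ) E := by
  let e := (Algebra.TensorProduct.basis E (Module.finBasis F V)).equivFun
  have he (x) : extend E φ x = coordForm (formCoeff φ) (e x) := extend_apply_eq_coordForm φ E x
  simp only [IsAnisotropicOver, not_forall]
  constructor
  · rintro ⟨x, hx0, hx⟩
    exact ⟨e x, by rwa [← he], by simpa using hx0⟩
  · rintro ⟨y, hy, hy0⟩
    exact ⟨e.symm y, by simpa using hy0, by rw [he, e.apply_symm_apply, hy]⟩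

theorem exists_isotropic_of_not_isAnisotropicOver
    (h : ¬ IsAnisotropicOver (formCoeff φ) F) : ∃ v : V, v ≠ 0 ∧ φ v = 0 := by
  simp only [IsAnisotropicOver, not_forall] at h
  obtain ⟨y, hy, hy0⟩ := h
  let e := (Module.finBasis F V).equivFun
  have he (x) : φ x = coordForm (formCoeff φ) (e x) := apply_eq_coordForm φ x
  exact ⟨e.symm y, by simpa using hy0, by rw [he, e.apply_symm_apply, hy]⟩

variable {φ}

theorem IsNondefective.exists_polar_ne_zero (hφ : IsNondefective φ) {v : V} (hv : φ v = 0)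
    (hv0 : v ≠ 0) : ∃ w, QuadraticMap.polar φ v w ≠ 0 := by
  by_contra! h
  have hmem : v ∈ φ.radical := QuadraticMap.mem_radical_iff'.2 ⟨hv, fun w => by
    have := h w
    rwa [QuadraticMap.polar, hv, sub_zero, sub_eq_zero] at this⟩
  rw [Submodule.finrank_eq_zero.1 hφ, Submodule.mem_bot] at hmem
  exact hv0 hmem

theorem representedGroup_extend_eq_top {v w : V} (hv : φ v = 0)
    (hvw : QuadraticMap.polar φ v w ≠ 0) (K : Type*) [Field K] [Algebra F K] :
    representedGroup (extend K φ) = ⊤ := by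
  refine representedGroup_eq_top (v := 1 ⊗ₜ v) (w := 1 ⊗ₜ w) ?_ ?_
  · rw [extend_tmul, hv, map_zero, mul_zero]
  · rw [polar_extend_tmul, one_mul, one_mul]
    exact (map_ne_zero _).2 hvw

theorem mem_representedGroup_iff (hone : (1 : F) ∈ represented φ) (a : Fˣ) :
    a ∈ representedGroup φ ↔ IsValueProduct (formCoeff φ) (a : F) := by
  have hQ := represented_eq_range_coordForm φ
  obtain ⟨e, he⟩ := hQ ▸ hone
  rw [← exists_mem_representedGroup_iff (K := F) hQ he]
  simp [← Units.ext_iff]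

theorem memGroupOverRational_iff (hone : (1 : F) ∈ represented φ) {l : ℕ}
    (f : MvPolynomial (Fin l) F) :
    MemGroupOverRational φ f ↔ IsValueProduct (formCoeff φ) f := by
  obtain ⟨e, he⟩ := represented_eq_range_coordForm φ ▸ hone
  exact exists_mem_representedGroup_iff (represented_extend_eq_range_coordForm φ _) he f

theorem isIsotropic_functionField_iff {l : ℕ} {f : MvPolynomial (Fin l) F} (hf : Prime f) :
    IsIsotropic (extend (FunctionField f) φ) ↔ IsIsotropicMod (formCoeff φ) f := by
  have : (Ideal.span {f}).IsPrime := (Ideal.span_singleton_prime hf.ne_zero).2 hf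
  rw [isIsotropic_extend_iff, isIsotropicMod_iff, not_iff_not]
  exact isAnisotropicOver_fractionRing_iff

end QuadraticForm

end CharTwoForms

theorem mainTheorem2 {F : Type*} [Field F] [CharP F 2]
    {V : Type*} [AddCommGroup V] [Module F V] [FiniteDimensional F V]
    (φ : QuadraticForm F V) (hφ : CharTwoForms.IsNondefective φ)
    (hone : (1 : F) ∈ CharTwoForms.represented φ)
    (l : ℕ) (hl : 0 < l) (r : ℕ) (a : Fˣ)
    (f : Fin r → MvPolynomial (Fin l) F) (g : MvPolynomial (Fin l) F)
    (hfmonic : ∀ k, CharTwoForms.IsMonic (f k)) (hgmonic : CharTwoForms.IsMonic g)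
    (hfdistinct : Function.Injective f) (hfirr : ∀ k, Irreducible (f k)) :
    List.TFAE [
      CharTwoForms.MemGroupOverRational φ (MvPolynomial.C (a : F) * (∏ k, f k) * g ^ 2),
      a ∈ CharTwoForms.representedGroup φ ∧ ∀ k, CharTwoForms.MemGroupOverRational φ (f k),
      a ∈ CharTwoForms.representedGroup φ ∧
        ∀ k, CharTwoForms.IsIsotropic
          (CharTwoForms.extend (CharTwoForms.FunctionField (f k)) φ)] := by
  open CharTwoForms in
  let m := MonomialOrder.lex (σ := Fin l)
  have hg0 : g ≠ 0 := hgmonic.ne_zero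
  have hprod0 : ∏ k, f k ≠ 0 := Finset.prod_ne_zero_iff.2 fun j _ => (hfirr j).ne_zero
  by_cases han : IsAnisotropicOver (formCoeff φ) F
  · simp only [memGroupOverRational_iff hone, mem_representedGroup_iff hone,
      isIsotropic_functionField_iff (hfirr _).prime]
    tfae_have 1 → 3 := by
      intro h
      have h1 := h.of_mul_sq
      refine ⟨?_, fun k => h1.isIsotropicMod (hfirr k).prime
        (odd_multiplicity_C_mul_prod m a.ne_zero hfmonic hfdistinct hfirr k)⟩
      have h2 := h1.leadingCoeff m han
      rwa [m.leadingCoeff_mul, m.leadingCoeff_C,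
        (MonomialOrder.Monic.prod fun k _ => hfmonic k : m.Monic _).leadingCoeff_eq_one,
        mul_one] at h2
    tfae_have 3 → 2 := by
      rintro ⟨ha, h⟩
      refine ⟨ha, fun k => ?_⟩
      obtain ⟨u, hu⟩ := han.satisfiesValueTheorem l (f k) (hfirr k).prime (h k)
      exact hu.of_unit_mul_monic m han (hfmonic k)
    tfae_have 2 → 1 := by
      rintro ⟨ha, h⟩
      refine (ha.mvPolynomial_C.mul ?_).mul_sq hg0
      exact Finset.prod_induction _ (IsValueProduct (formCoeff φ)) (fun _ _ => .mul)
        isValueProduct_one fun k _ => h k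
    tfae_finish
  · -- An isotropic nondefective form represents everything, so that all conditions hold.
    obtain ⟨v, hv0, hv⟩ := exists_isotropic_of_not_isAnisotropicOver φ han
    obtain ⟨w, hw⟩ := hφ.exists_polar_ne_zero hv hv0
    have ha : a ∈ representedGroup φ := by
      rw [representedGroup_eq_top hv hw]; trivial
    have hmem (p : MvPolynomial (Fin l) F) (hp : p ≠ 0) : MemGroupOverRational φ p :=
      ⟨Units.mk0 (algebraMap _ _ p)
          ((map_ne_zero_iff _ (IsFractionRing.injective _ (RationalFunctionField F l))).2 hp),
        by rw [representedGroup_extend_eq_top hv hw]; trivial, rfl⟩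
    have hiso (k : Fin r) : IsIsotropic (extend (FunctionField (f k)) φ) := by
      have : (Ideal.span {f k}).IsPrime :=
        (Ideal.span_singleton_prime (hfirr k).ne_zero).2 (hfirr k).prime
      rw [isIsotropic_extend_iff]
      exact fun h => han (h.of_injective _ (e := Algebra.ofId F (FunctionField (f k)))
        (algebraMap F (FunctionField (f k))).injective)
    have h1 := hmem (MvPolynomial.C (a : F) * (∏ k, f k) * g ^ 2)
      (mul_ne_zero (mul_ne_zero (by simp) hprod0) (pow_ne_zero 2 hg0))
    have h2 (k : Fin r) := hmem (f k) (hfirr k).ne_zero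
    tfae_have 1 → 2 := fun _ => ⟨ha, h2⟩
    tfae_have 2 → 3 := fun _ => ⟨ha, hiso⟩
    tfae_have 3 → 1 := fun _ => h1
    tfae_finish
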